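/- Let $K\ge 1$, $m=(m_1,\dots,m_K)\in\mathbb Z_+^K$, $n\in\mathbb Z_+$, and let $\lambda=(\lambda_1,\dots,\lambda_K)$, $\mu=(\mu_1,\dots,\mu_K)$ have strictly positive entries. The two-layer loss system with parameters $(m,n,\lambda,\mu)$ is the continuous-time Markov process on $$S=\Big\{x=(x_{i,k})\in\mathbb Z_+^K\times\mathbb Z_+^K:\ x_{1,k}\le m_k\ \forall k,\ \sum_k x_{2,k}\le n\Big\}$$ with transitions $x\mapsto x+e_{i,k}$ at rate $\lambda_k 1(x\in A_{i,k})$ and $x\mapsto x-e_{i,k}$ at rate $\mu_k x_{i,k}$, where $A_{1,k}=\{x\in S: x_{1,k}<m_k\}$ and $A_{2,k}=\{x\in S: x_{1,k}=m_k,\ \sum_l x_{2,l}<n\}$. The maximum packing system (superscript mp) with the same parameters has the same state space and upward transition rates, but transitions $x\mapsto x-e_{1,k}$ at rate $\mu_k x_{1,k}1(x_{2,k}=0)$ and $x\mapsto x-e_{2,k}$ at rate $\mu_k x_{1,k}1(x_{2,k}>0)+\mu_k x_{2,k}$. Let $\bar X$, $\bar X^{\rm mp}$ be random vectors with the stationary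 distributions of these processes, and let $|x|=\sum_{i,k}x_{i,k}$. For either system let $a=\mathrm E|\bar X|$ be the stationary mean number of customers, $\theta$ the stationary mean throughput (the mean number of service completions per unit time, i.e. the stationary mean of the total downward rate), and $$b=\sum_k\frac{\lambda_k}{\sum_l\lambda_l}\,\mathrm P(\bar X\in B_k),\qquad B_k=\Big\{x\in S: x_{1,k}=m_k,\ \sum_l x_{2,l}=n\Big\},$$ the stationary overall blocking probability. Quantities without arguments refer to the system $(m,n,\lambda,\mu)$. Let $\mu_{\min}=\min_k\mu_k$, $\mu_{\max}=\max_k\mu_k$, $r_\mu=\mu_{\max}/\mu_{\min}$, let $\mu^{\min}$ and $\mu^{\max}$ be the constant vectors with entries $\mu_{\min}$ and $\mu_{\max}$, and let $$C_{m,n}=\Big\{m'\in\mathbb Z_+^K:\ m'_k\ge m_k\ \forall k,\ \sum_k m'_k=\sum_k m_k+n\Big\}.$$ Write $U\le_{\rm st}V$ if $\mathrm E f(U)\le\mathrm E f(V)$ for all bounded measurable increasing $f:\mathbb R\to\mathbb R$. Theorem. The systems $(m,n,\lambda,\mu)$, $(m',0,\lambda,\mu^{\max})$ for $m'\in C_{m,n}$,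 and the maximum packing system $(m,n,\lambda,\mu^{\min})$ each have a unique stationary distribution, and for all $m'\in C_{m,n}$ $$|\bar X(m',0,\lambda,\mu^{\max})|\le_{\rm st}|\bar X|\le_{\rm st}|\bar X^{\rm mp}(m,n,\lambda,\mu^{\min})|.$$ Moreover, $$\max_{m'\in C_{m,n}}a(m',0,\lambda,\mu^{\max})\le a\le a^{\rm mp}(m,n,\lambda,\mu^{\min}),$$ $$\max_{m'\in C_{m,n}}r_\mu^{-1}\theta(m',0,\lambda,\mu^{\max})\le\theta\le r_\mu\,\theta^{\rm mp}(m,n,\lambda,\mu^{\min}),$$ $$1-r_\mu\big(1-b^{\rm mp}(m,n,\lambda,\mu^{\min})\big)\le b\le\min_{m'\in C_{m,n}}\Big(1-r_\mu^{-1}\big(1-b(m',0,\lambda,\mu^{\max})\big)\Big).$$ -/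

import Mathlib

namespace TwoLayerLoss

open scoped Matrix

noncomputable section

variable {K : ℕ}

/-- The state space `S`: pairs `x = (x.1, x.2)` of vectors in `ℤ₊^K`, where `x.1 k` and `x.2 k` are
the numbers of class-`k` customers in layers 1 and 2, with `x.1 k ≤ m k` for all `k` and
`∑ k, x.2 k ≤ n`. -/
abbrev State (m : Fin K → ℕ) (n : ℕ) : Type :=
  {x : (Fin K → ℕ) × (Fin K → ℕ) // (∀ k, x.1 k ≤ m k) ∧ ∑ k, x.2 k ≤ n}

instance instFiniteState (m : Fin K → ℕ) (n : ℕ) : Finite (State m n) := by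
  refine Set.Finite.to_subtype (Set.Finite.subset
    ((Set.finite_Icc (0 : Fin K → ℕ) m).prod (Set.finite_Icc (0 : Fin K → ℕ) fun _ => n)) ?_)
  rintro x ⟨h1, h2⟩
  refine ⟨⟨fun k => Nat.zero_le _, h1⟩, ⟨fun k => Nat.zero_le _, fun k => ?_⟩⟩
  exact (Finset.single_le_sum (f := x.2) (fun _ _ => Nat.zero_le _) (Finset.mem_univ k)).trans h2

instance instFintypeState (m : Fin K → ℕ) (n : ℕ) : Fintype (State m n) := Fintype.ofFinite _

/-- The two layers of servers. -/
inductive Layer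
  | one
  | two

instance instFintypeLayer : Fintype Layer :=
  Fintype.ofEquiv Bool
    { toFun := fun b => bif b then Layer.one else Layer.two
      invFun := fun i => match i with
        | Layer.one => true
        | Layer.two => false
      left_inv := by intro b; cases b <;> rfl
      right_inv := by intro i; cases i <;> rfl }

/-- The unit vector `e_{i,k}` of `ℤ₊^K × ℤ₊^K`. -/
def unit (i : Layer) (k : Fin K) : (Fin K → ℕ) × (Fin K → ℕ) :=
  match i with
  | .one => (Pi.single k 1, 0)
  | .two => (0, Pi.single k 1)

/-- The total number of customers `|x|`, as a real number. -/
def total {m : Fin K → ℕ} {n : ℕ} (x : State m n) : ℝ :=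
  ((∑ k, x.1.1 k + ∑ k, x.1.2 k : ℕ) : ℝ)

/-- `A_{i,k}`: the states in which an arriving class-`k` customer is assigned to layer `i`. -/
def acceptSet (m : Fin K → ℕ) (n : ℕ) (i : Layer) (k : Fin K) : Set (State m n) :=
  match i with
  | .one => {x | x.1.1 k < m k}
  | .two => {x | x.1.1 k = m k ∧ ∑ l, x.1.2 l < n}

/-- `B_k`: the states in which an arriving class-`k` customer is rejected. -/
def blockSet (m : Fin K → ℕ) (n : ℕ) (k : Fin K) : Set (State m n) :=
  {x | x.1.1 k = m k ∧ ∑ l, x.1.2 l = n}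

/-- The two service disciplines: plain overflow routing (the original system), and maximum
packing, where a customer is moved from layer 2 to layer 1 as soon as a server dedicated to its
class becomes vacant there. -/
inductive Policy
  | overflow
  | maxPacking

open Classical in
/-- The rate of the upward transition `x ↦ x + e_{i,k}` (the same under both policies). -/
def upRate (m : Fin K → ℕ) (n : ℕ) (lam : Fin K → ℝ) (i : Layer) (k : Fin K)
    (x : State m n) : ℝ :=
  if x ∈ acceptSet m n i k then lam k else 0

/-- The rate of the downward transition `x ↦ x - e_{i,k}`. -/
def downRate (P : Policy) (m : Fin K → ℕ) (n : ℕ) (mu : Fin K → ℝ) (i : Layer) (k : Fin K)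
    (x : State m n) : ℝ :=
  match P, i with
  | .overflow, .one => mu k * x.1.1 k
  | .overflow, .two => mu k * x.1.2 k
  | .maxPacking, .one => if x.1.2 k = 0 then mu k * x.1.1 k else 0
  | .maxPacking, .two => (if 0 < x.1.2 k then mu k * x.1.1 k else 0) + mu k * x.1.2 k

/-- The total rate of jumps from `x` to `y`. -/
def jumpRate (P : Policy) (m : Fin K → ℕ) (n : ℕ) (lam mu : Fin K → ℝ)
    (x y : State m n) : ℝ :=
  ∑ i, ∑ k,
    ((if y.1 = x.1 + unit i k then upRate m n lam i k x else 0) +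
      (if x.1 = y.1 + unit i k then downRate P m n mu i k x else 0))

/-- The infinitesimal generator of the Markov process. -/
def generator (P : Policy) (m : Fin K → ℕ) (n : ℕ) (lam mu : Fin K → ℝ) :
    Matrix (State m n) (State m n) ℝ :=
  fun x y =>
    if x = y then -∑ z ∈ Finset.univ.erase x, jumpRate P m n lam mu x z
    else jumpRate P m n lam mu x y

/-- The transition matrix over a time interval of length `t`. -/
def transition (P : Policy) (m : Fin K → ℕ) (n : ℕ) (lam mu : Fin K → ℝ) (t : ℝ) :
    Matrix (State m n) (State m n) ℝ :=
  NormedSpace.exp (t • generator P m n lam mu)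

/-- `p` is a stationary distribution: a probability vector on `S` that is invariant under the
transition matrices of all time intervals. -/
def IsStationary (P : Policy) (m : Fin K → ℕ) (n : ℕ) (lam mu : Fin K → ℝ)
    (p : State m n → ℝ) : Prop :=
  p ∈ stdSimplex ℝ (State m n) ∧ ∀ t : ℝ, 0 ≤ t → p ᵥ* transition P m n lam mu t = p

/-- The stationary distribution, i.e. the law of the stationary state (it is determined by
`IsStationary` whenever the latter has exactly one solution). -/
def stationary (P : Policy) (m : Fin K → ℕ) (n : ℕ) (lam mu : Fin K → ℝ) :
    State m n → ℝ :=
  Classical.epsilon (IsStationary P m n lam mu)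

/-- The expectation of `g` under the probability vector `p`. -/
def expect {σ : Type} [Fintype σ] (p : σ → ℝ) (g : σ → ℝ) : ℝ :=
  ∑ x, p x * g x

/-- The usual stochastic order `U ≤_st V` for real random variables `U` on the finite probability
space `(σ, p)` and `V` on the finite probability space `(τ, q)`. -/
def StLE {σ τ : Type} [Fintype σ] [Fintype τ] (p : σ → ℝ) (U : σ → ℝ) (q : τ → ℝ)
    (V : τ → ℝ) : Prop :=
  ∀ f : ℝ → ℝ, Measurable f → (∃ C, ∀ u, |f u| ≤ C) → Monotone f →
    expect p (fun x => f (U x)) ≤ expect q (fun y => f (V y))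

/-- The stationary mean total number of customers `a`. -/
def meanNumber (P : Policy) (m : Fin K → ℕ) (n : ℕ) (lam mu : Fin K → ℝ) : ℝ :=
  expect (stationary P m n lam mu) total

/-- The stationary mean class-`k` throughput `θ_k`: the mean number of class-`k` customers that
complete service per unit time. -/
def classThroughput (P : Policy) (m : Fin K → ℕ) (n : ℕ) (lam mu : Fin K → ℝ) (k : Fin K) : ℝ :=
  expect (stationary P m n lam mu) (fun x => ∑ i, downRate P m n mu i k x)

/-- The stationary mean throughput `θ`. -/
def throughput (P : Policy) (m : Fin K → ℕ) (n : ℕ) (lam mu : Fin K → ℝ) : ℝ :=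
  ∑ k, classThroughput P m n lam mu k

open Classical in
/-- The stationary class-`k` blocking probability: the stationary probability of `B_k`. -/
def classBlocking (P : Policy) (m : Fin K → ℕ) (n : ℕ) (lam mu : Fin K → ℝ) (k : Fin K) : ℝ :=
  expect (stationary P m n lam mu) (fun x => if x ∈ blockSet m n k then 1 else 0)

/-- The stationary overall blocking probability `b`: an arriving customer is of class `k` with
probability `lam k / ∑ l, lam l`. -/
def blocking (P : Policy) (m : Fin K → ℕ) (n : ℕ) (lam mu : Fin K → ℝ) : ℝ :=
  ∑ k, (lam k / ∑ l, lam l) * classBlocking P m n lam mu k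

/-- `μ_min`. -/
def muMin [NeZero K] (mu : Fin K → ℝ) : ℝ := Finset.univ.inf' Finset.univ_nonempty mu

/-- `μ_max`. -/
def muMax [NeZero K] (mu : Fin K → ℝ) : ℝ := Finset.univ.sup' Finset.univ_nonempty mu

/-- `r_μ = μ_max / μ_min`. -/
def muRatio [NeZero K] (mu : Fin K → ℝ) : ℝ := muMax mu / muMin mu

/-- `C_{m,n}`: the server configurations where all layer-2 servers have been replaced by servers
in layer 1. -/
def configs (m : Fin K → ℕ) (n : ℕ) : Finset (Fin K → ℕ) :=
  (Finset.Icc m (fun k => m k + n)).filter (fun m' => ∑ k, m' k = ∑ k, m k + n)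

theorem mem_configs (m : Fin K → ℕ) (n : ℕ) (m' : Fin K → ℕ) :
    m' ∈ configs m n ↔ (∀ k, m k ≤ m' k) ∧ ∑ k, m' k = ∑ k, m k + n := by
  simp only [configs, Finset.mem_filter, Finset.mem_Icc]
  constructor
  · rintro ⟨⟨h1, -⟩, h2⟩
    exact ⟨h1, h2⟩
  · rintro ⟨h1, h2⟩
    refine ⟨⟨h1, fun k => ?_⟩, h2⟩
    have h3 : ∑ l, (m' l - m l) = n := by
      have h4 : ∑ l, (m' l - m l) + ∑ l, m l = ∑ l, m' l := by
        rw [← Finset.sum_add_distrib]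
        exact Finset.sum_congr rfl fun l _ => Nat.sub_add_cancel (h1 l)
      omega
    have h5 := Finset.single_le_sum (f := fun l => m' l - m l) (fun _ _ => Nat.zero_le _)
      (Finset.mem_univ k)
    simp only [h3] at h5
    show m' k ≤ m k + n
    omega

theorem configs_nonempty [NeZero K] (m : Fin K → ℕ) (n : ℕ) : (configs m n).Nonempty := by
  refine ⟨m + Pi.single 0 n, (mem_configs m n _).2 ⟨fun k => ?_, ?_⟩⟩
  · simp
  · simp [Finset.sum_add_distrib]

end

end TwoLayerLoss

open TwoLayerLoss

/-!
The proof couples two loss systems so that `|x| ≤ |y|` is preserved for ever. The inequality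
`|x| ≤ |y|` alone is not preserved: an arriving customer may be blocked in the fuller system only.
The invariant used (`Dominated`) adds that, for each class, layer 1 of the lower system `x` has at
least as many vacancies as layer 1 of the upper system `y`. If the two systems have the same total
number of servers and the lower one dedicates more of them, then an arrival accepted by `x` alone
finds no vacancy in layer 2 nor in the layer 1 of its class in `y`, so that `x` has strictly more
vacancies, i.e. `|x| < |y|` (`Dominated.arrive`). Departures from `y` need company in two situations: a layer-1 departure of a
class with equal vacancies, and any departure if `|x| = |y|`. In both, the lower system has at least
the departure rate required as soon as its service rates dominate those of the upper system
(`Dominated.localCoupling`). Since only the total rate of class-`k` departures and a bound on its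
layer-1 part enter, the upper system may follow either discipline, and one comparison
`expect_total_le` gives both stochastic bounds: `(m', 0)` with rates `μ_max` below `(m, n)`, and
`(m, n)` below maximum packing with rates `μ_min`.

The coupling is used in equilibrium only. Joint jump rates are chosen at every pair of related
states; the resulting finite process has some invariant distribution, whose marginals are invariant
for the two systems (`exists_invariant_coupled`) and hence are their stationary distributions, which
are unique because the empty state is accessible from all states (`existsUnique_isStationary`).

For the other bounds, the throughput lies between `μ_min a` and `μ_max a`, with equality when the
service rates are constant, and the balance of flows `(∑ k, lam k) (1 - b) = θ` (`blocking_eq`)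
turns bounds of the throughput into bounds of the blocking probability.
-/

namespace TwoLayerLoss

open scoped Matrix

noncomputable section

/-! ### Invariant measures of finite jump processes -/

/-- The generator of the jump process with rates `c`, applied to `f` at `x`. Diagonal rates
`c x x` are allowed and have no effect. -/
def jumpGen {σ : Type*} [Fintype σ] (c : σ → σ → ℝ) (f : σ → ℝ) (x : σ) : ℝ :=
  ∑ y, c x y * (f y - f x)

/-- `u` is an invariant signed measure for the jump rates `c`, tested against all functions.
No sign or normalization of `u` is required. -/
def IsInvariant {σ : Type*} [Fintype σ] (c : σ → σ → ℝ) (u : σ → ℝ) : Prop :=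
  ∀ f : σ → ℝ, ∑ x, u x * jumpGen c f x = 0

section Finite

variable {σ : Type*} [Fintype σ] {c : σ → σ → ℝ} {u : σ → ℝ}

theorem sum_mul_jumpGen (c : σ → σ → ℝ) (u f : σ → ℝ) :
    ∑ x, u x * jumpGen c f x = ∑ y, (∑ x, u x * c x y - u y * ∑ z, c y z) * f y := by
  simp only [jumpGen, mul_sub, sub_mul, Finset.sum_sub_distrib, Finset.sum_mul, Finset.mul_sum]
  congr 1
  · rw [Finset.sum_comm]
    exact Finset.sum_congr rfl fun _ _ => Finset.sum_congr rfl fun _ _ => by ring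
  · exact Finset.sum_congr rfl fun _ _ => Finset.sum_congr rfl fun _ _ => by ring

/-- Invariance is the balance of total inflow and total outflow at every state. -/
theorem isInvariant_iff :
    IsInvariant c u ↔ ∀ y, ∑ x, u x * c x y = u y * ∑ z, c y z := by
  classical
  constructor
  · intro h y
    have := h (Pi.single y 1)
    rw [sum_mul_jumpGen] at this
    simp only [Pi.single_apply, mul_ite, mul_one, mul_zero, Finset.sum_ite_eq',
      Finset.mem_univ, if_true] at this
    linarith
  · intro h f
    rw [sum_mul_jumpGen]
    exact Finset.sum_eq_zero fun y _ => by rw [h y, sub_self, zero_mul]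

/-- The total variation of an invariant signed measure is invariant: the triangle inequality makes
`|u|` at most balanced at every state, and the two sides have equal sums. -/
theorem IsInvariant.abs (hc : ∀ x y, 0 ≤ c x y) (h : IsInvariant c u) :
    IsInvariant c |u| := by
  rw [isInvariant_iff] at h ⊢
  have hle : ∀ y ∈ Finset.univ, |u| y * ∑ z, c y z ≤ ∑ x, |u| x * c x y := by
    intro y _
    calc |u| y * ∑ z, c y z = |u y * ∑ z, c y z| := by
          rw [abs_mul, abs_of_nonneg (Finset.sum_nonneg fun z _ => hc y z), Pi.abs_apply]
      _ = |∑ x, u x * c x y| := by rw [h y]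
      _ ≤ ∑ x, |u x * c x y| := Finset.abs_sum_le_sum_abs _ _
      _ = ∑ x, |u| x * c x y := Finset.sum_congr rfl fun x _ => by
          rw [abs_mul, abs_of_nonneg (hc x y), Pi.abs_apply]
  have hsum : ∑ y, |u| y * ∑ z, c y z = ∑ y, ∑ x, |u| x * c x y := by
    rw [Finset.sum_comm]
    simp only [Finset.mul_sum]
  exact fun y => (((Finset.sum_eq_sum_iff_of_le hle).1 hsum) y (Finset.mem_univ y)).symm

/-- The generator kills constants, so its transpose has a nonzero kernel vector; normalizing the
absolute value of that vector gives an invariant distribution. No irreducibility is needed, so this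
applies to the coupled process, about whose communicating classes nothing is known. -/
theorem exists_invariant_mem_stdSimplex [Nonempty σ] (hc : ∀ x y, 0 ≤ c x y) :
    ∃ p ∈ stdSimplex ℝ σ, IsInvariant c p := by
  classical
  obtain ⟨v, hv0, hv⟩ : ∃ v : σ → ℝ, v ≠ 0 ∧ IsInvariant c v := by
    let A : Matrix σ σ ℝ := fun x y => c x y - if x = y then ∑ z, c x z else 0
    have hdet : A.det = 0 := by
      refine Matrix.exists_mulVec_eq_zero_iff.1 ⟨1, one_ne_zero, ?_⟩
      ext x
      simp [A, Matrix.mulVec, dotProduct]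
    obtain ⟨v, hv0, hv⟩ := Matrix.exists_vecMul_eq_zero_iff.2 hdet
    refine ⟨v, hv0, isInvariant_iff.2 fun y => ?_⟩
    have := congrFun hv y
    simp only [A, Matrix.vecMul, dotProduct, mul_sub, mul_ite, mul_zero, Finset.sum_sub_distrib,
      Finset.sum_ite_eq', Finset.mem_univ, if_true, Pi.zero_apply] at this
    linarith
  have habs := hv.abs hc
  have hpos : 0 < ∑ x, |v| x := by
    obtain ⟨x, hx⟩ := Function.ne_iff.1 hv0
    exact Finset.sum_pos' (fun x _ => abs_nonneg _) ⟨x, Finset.mem_univ x, abs_pos.2 hx⟩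
  refine ⟨fun x => (∑ x, |v| x)⁻¹ * |v| x, ⟨fun x => ?_, ?_⟩, fun f => ?_⟩
  · exact mul_nonneg (inv_nonneg.2 hpos.le) (abs_nonneg _)
  · rw [← Finset.mul_sum, inv_mul_cancel₀ hpos.ne']
  · simp only [mul_assoc, ← Finset.mul_sum, habs f, mul_zero]

theorem IsInvariant.pos_of_reflTransGen (hc : ∀ x y, 0 ≤ c x y) (hu : ∀ x, 0 ≤ u x)
    (h : IsInvariant c u) {x y : σ} (hxy : Relation.ReflTransGen (fun a b => 0 < c a b) x y)
    (hx : 0 < u x) : 0 < u y := by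
  induction hxy with
  | refl => exact hx
  | @tail a b _ hab ih =>
    refine (hu b).lt_of_ne fun h0 => ?_
    have hb := isInvariant_iff.1 h b
    rw [← h0, zero_mul] at hb
    exact (mul_pos ih hab).ne' ((Finset.sum_eq_zero_iff_of_nonneg
      fun x _ => mul_nonneg (hu x) (hc x b)).1 hb a (Finset.mem_univ a))

theorem IsInvariant.unique (hc : ∀ x y, 0 ≤ c x y) {o : σ}
    (ho : ∀ x, Relation.ReflTransGen (fun a b => 0 < c a b) x o) {p q : σ → ℝ}
    (hp : p ∈ stdSimplex ℝ σ) (hq : q ∈ stdSimplex ℝ σ)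
    (hip : IsInvariant c p) (hiq : IsInvariant c q) : p = q := by
  have hv : IsInvariant c (p - q) := fun f => by
    simp only [Pi.sub_apply, sub_mul, Finset.sum_sub_distrib, hip f, hiq f, sub_zero]
  have habs := hv.abs hc
  have h1 : IsInvariant c (|p - q| + (p - q)) := fun f => by
    simp only [Pi.add_apply, add_mul, Finset.sum_add_distrib, habs f, hv f, add_zero]
  have h2 : IsInvariant c (fun x => |p - q| x - (p - q) x) := fun f => by
    simp only [sub_mul, Finset.sum_sub_distrib, habs f, hv f, sub_zero]
  have n1 : ∀ x, 0 ≤ (|p - q| + (p - q)) x := fun x => by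
    have := neg_abs_le ((p - q) x)
    simp only [Pi.add_apply, Pi.abs_apply] at *
    linarith
  have n2 : ∀ x, 0 ≤ |p - q| x - (p - q) x := fun x => sub_nonneg.2 (le_abs_self ((p - q) x))
  have hs : ∑ x, (p - q) x = 0 := by
    simp only [Pi.sub_apply, Finset.sum_sub_distrib, hp.2, hq.2, sub_self]
  -- Were both parts of `p - q` nonzero, both would charge `o`, where their product vanishes.
  have key : (∀ x, (p - q) x ≤ 0) ∨ (∀ x, 0 ≤ (p - q) x) := by
    by_contra! hcon
    obtain ⟨⟨x, hx⟩, ⟨y, hy⟩⟩ := hcon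
    have a1 := h1.pos_of_reflTransGen hc n1 (ho x) (by
      have := abs_nonneg ((p - q) x)
      simp only [Pi.add_apply, Pi.abs_apply] at *
      linarith)
    have a2 := h2.pos_of_reflTransGen hc n2 (ho y) (by
      have := abs_nonneg ((p - q) y)
      simp only [Pi.sub_apply, Pi.abs_apply] at *
      linarith)
    simp only [Pi.add_apply, Pi.sub_apply, Pi.abs_apply] at a1 a2
    rcases abs_cases (p o - q o) with ⟨e, _⟩ | ⟨e, _⟩ <;> rw [e] at a1 a2 <;> linarith
  have hz : ∀ x, (p - q) x = 0 := by
    rcases key with h | h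
    · exact fun x => (Finset.sum_eq_zero_iff_of_nonpos fun x _ => h x).1 hs x (Finset.mem_univ x)
    · exact fun x => (Finset.sum_eq_zero_iff_of_nonneg fun x _ => h x).1 hs x (Finset.mem_univ x)
  exact funext fun x => sub_eq_zero.1 (hz x)

open scoped Matrix.Norms.Operator in
/-- Invariance under the semigroup `exp (t • Q)` is the same as being killed by `Q`, by
differentiating at `t = 0` from the right, respectively by constancy of a map with zero derivative. -/
theorem forall_vecMul_exp_eq_iff [DecidableEq σ] (Q : Matrix σ σ ℝ) (p : σ → ℝ) :
    (∀ t : ℝ, 0 ≤ t → p ᵥ* NormedSpace.exp (t • Q) = p) ↔ p ᵥ* Q = 0 := by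
  let T : Matrix σ σ ℝ →L[ℝ] (σ → ℝ) := LinearMap.toContinuousLinearMap (Matrix.vecMulBilin ℝ ℝ p)
  have hT : ∀ A, T A = p ᵥ* A := fun A => rfl
  have hd : ∀ t : ℝ, HasDerivAt (fun t : ℝ => p ᵥ* NormedSpace.exp (t • Q))
      (p ᵥ* (Q * NormedSpace.exp (t • Q))) t := fun t =>
    T.hasFDerivAt.comp_hasDerivAt t (hasDerivAt_exp_smul_const' Q t)
  constructor
  · intro h
    have h0 := (hd 0).hasDerivWithinAt (s := Set.Ici 0)
    have h1 : HasDerivWithinAt (fun t : ℝ => p ᵥ* NormedSpace.exp (t • Q)) 0 (Set.Ici 0) 0 :=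
      (hasDerivWithinAt_const (0 : ℝ) (Set.Ici 0) p).congr (fun t ht => h t ht) (h 0 le_rfl)
    have := (uniqueDiffWithinAt_Ici (0 : ℝ)).eq_deriv _ h0 h1
    simpa using this
  · intro h t _
    have hconst := is_const_of_deriv_eq_zero (fun t => (hd t).differentiableAt)
      (fun t => by rw [(hd t).deriv, ← Matrix.vecMul_vecMul, h, Matrix.zero_vecMul]) t 0
    simpa using hconst

end Finite

/-! ### Couplings of jump processes -/

/-- `LocalCoupling R x y A B`: there are nonnegative rates `c` of joint jumps from `(x, y)`, charging
only pairs in `R`, whose two marginal generators are `A` and `B`. As `A` and `B` only involve the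
values at the jump targets, a joint jump may leave one of the two coordinates in place. -/
def LocalCoupling {σ τ : Type*} [Fintype σ] [Fintype τ] (R : σ → τ → Prop) (x : σ) (y : τ)
    (A : (σ → ℝ) → ℝ) (B : (τ → ℝ) → ℝ) : Prop :=
  ∃ c : σ × τ → ℝ, (∀ z, 0 ≤ c z) ∧ (∀ z, c z ≠ 0 → R z.1 z.2) ∧
    (∀ f, ∑ z, c z * (f z.1 - f x) = A f) ∧ ∀ g, ∑ z, c z * (g z.2 - g y) = B g

namespace LocalCoupling

variable {σ τ : Type*} [Fintype σ] [Fintype τ] {R : σ → τ → Prop} {x : σ} {y : τ}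

theorem zero : LocalCoupling R x y 0 0 :=
  ⟨0, fun _ => le_rfl, fun _ h => absurd rfl h, by simp, by simp⟩

theorem add {A A' : (σ → ℝ) → ℝ} {B B' : (τ → ℝ) → ℝ} (h : LocalCoupling R x y A B)
    (h' : LocalCoupling R x y A' B') : LocalCoupling R x y (A + A') (B + B') := by
  obtain ⟨c, c0, cR, cA, cB⟩ := h
  obtain ⟨d, d0, dR, dA, dB⟩ := h'
  refine ⟨c + d, fun z => add_nonneg (c0 z) (d0 z), fun z hz => ?_, fun f => ?_, fun g => ?_⟩
  · by_cases hcz : c z = 0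
    · exact dR z fun hdz => hz (by simp [hcz, hdz])
    · exact cR z hcz
  · simp only [Pi.add_apply, add_mul, Finset.sum_add_distrib, cA, dA]
  · simp only [Pi.add_apply, add_mul, Finset.sum_add_distrib, cB, dB]

theorem sum {ι : Type*} (s : Finset ι) {A : ι → (σ → ℝ) → ℝ} {B : ι → (τ → ℝ) → ℝ}
    (h : ∀ i ∈ s, LocalCoupling R x y (A i) (B i)) :
    LocalCoupling R x y (∑ i ∈ s, A i) (∑ i ∈ s, B i) := by
  classical
  induction s using Finset.induction_on with
  | empty => simpa using zero
  | insert i s hi ih =>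
    rw [Finset.sum_insert hi, Finset.sum_insert hi]
    exact (h i (Finset.mem_insert_self i s)).add
      (ih fun j hj => h j (Finset.mem_insert_of_mem hj))

theorem joint_jump {r : ℝ} (hr : 0 ≤ r) {x' : σ} {y' : τ} (h : r ≠ 0 → R x' y') :
    LocalCoupling R x y (fun f => r * (f x' - f x)) (fun g => r * (g y' - g y)) := by
  classical
  refine ⟨Pi.single (x', y') r, fun z => ?_, fun z hz => ?_, fun f => ?_, fun g => ?_⟩
  · rw [Pi.single_apply]; split_ifs <;> simp [hr]
  · rw [Pi.single_apply] at hz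
    split_ifs at hz with e
    · rw [e]; exact h hz
    · exact absurd rfl hz
  · simp [Pi.single_apply]
  · simp [Pi.single_apply]

variable {ι κ : Type*} [Fintype ι] [Fintype κ] {a : ι → ℝ} {b : κ → ℝ} {s : ι → σ} {t : κ → τ}

/-- Jumps of the two coordinates that need not be synchronized. -/
theorem independent (ha : ∀ i, 0 ≤ a i) (hb : ∀ j, 0 ≤ b j) (hs : ∀ i, a i ≠ 0 → R (s i) y)
    (ht : ∀ j, b j ≠ 0 → R x (t j)) :
    LocalCoupling R x y (fun f => ∑ i, a i * (f (s i) - f x))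
      (fun g => ∑ j, b j * (g (t j) - g y)) := by
  have h1 := LocalCoupling.sum (R := R) (x := x) (y := y) Finset.univ
    fun i _ => joint_jump (ha i) (hs i)
  have h2 := LocalCoupling.sum (R := R) (x := x) (y := y) Finset.univ
    fun j _ => joint_jump (hb j) (ht j)
  convert h1.add h2 using 1 <;> ext f <;> simp

/-- If the left total rate dominates the right one, every right jump can be accompanied by a left
jump, with joint rates proportional to the products `a i * b j`; what remains of the left rates is
used for jumps of the left coordinate alone. -/
theorem proportional (ha : ∀ i, 0 ≤ a i) (hb : ∀ j, 0 ≤ b j) (hab : ∑ j, b j ≤ ∑ i, a i)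
    (hs : ∀ i, a i ≠ 0 → R (s i) y) (hst : ∀ i j, a i ≠ 0 → b j ≠ 0 → R (s i) (t j)) :
    LocalCoupling R x y (fun f => ∑ i, a i * (f (s i) - f x))
      (fun g => ∑ j, b j * (g (t j) - g y)) := by
  have hb0 : 0 ≤ ∑ j, b j := Finset.sum_nonneg fun j _ => hb j
  rcases (hb0.trans hab).eq_or_lt with hS | hS
  · have hbz : ∀ j, b j = 0 := fun j =>
      (Finset.sum_eq_zero_iff_of_nonneg fun j _ => hb j).1 (le_antisymm (hS ▸ hab) hb0) j
        (Finset.mem_univ j)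
    exact independent ha hb hs fun j hj => absurd (hbz j) hj
  set S := ∑ i, a i with hSdef
  have h1 := LocalCoupling.sum (R := R) (x := x) (y := y) Finset.univ
    fun (ij : ι × κ) _ => joint_jump (r := a ij.1 * b ij.2 / S) (x' := s ij.1) (y' := t ij.2)
      (div_nonneg (mul_nonneg (ha _) (hb _)) hS.le) fun h => hst ij.1 ij.2
        (fun h0 => h (by simp [h0])) (fun h0 => h (by simp [h0]))
  have h2 := LocalCoupling.sum (R := R) (x := x) (y := y) Finset.univ
    fun (i : ι) _ => joint_jump (r := a i * (1 - (∑ j, b j) / S)) (x' := s i) (y' := y)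
      (mul_nonneg (ha i) (sub_nonneg.2 ((div_le_one hS).2 hab)))
      fun h => hs i fun h0 => h (by simp [h0])
  convert h1.add h2 using 1
  · ext f
    simp only [Pi.add_apply, Finset.sum_apply, Fintype.sum_prod_type, ← Finset.sum_mul,
      ← Finset.sum_add_distrib]
    refine Finset.sum_congr rfl fun i _ => ?_
    rw [← Finset.sum_div, ← Finset.mul_sum, ← add_mul]
    congr 1
    ring
  · ext g
    simp only [Pi.add_apply, Finset.sum_apply, Fintype.sum_prod_type_right, sub_self, mul_zero,
      Finset.sum_const_zero, add_zero, ← Finset.sum_mul]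
    refine Finset.sum_congr rfl fun j _ => ?_
    rw [← Finset.sum_div, ← Finset.sum_mul, ← hSdef, mul_div_cancel_left₀ _ hS.ne']

end LocalCoupling

open Classical in
theorem sum_fiber_mul {ω α : Type*} [Fintype ω] [Fintype α] (π : ω → ℝ) (pr : ω → α)
    (f : α → ℝ) :
    ∑ x, (∑ w, if pr w = x then π w else 0) * f x = ∑ w, π w * f (pr w) := by
  simp only [Finset.sum_mul, ite_mul, zero_mul]
  rw [Finset.sum_comm]
  simp

/-- Local couplings at all pairs of a nonempty relation `R` assemble into a jump process on `R`. The
marginals of an invariant distribution of that process are invariant, and are ordered on all pairs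
of functions that are ordered along `R`. -/
theorem exists_invariant_coupled {σ τ : Type*} [Fintype σ] [Fintype τ] {R : σ → τ → Prop}
    {c : σ → σ → ℝ} {d : τ → τ → ℝ} (hR : ∃ x y, R x y)
    (h : ∀ x y, R x y →
      LocalCoupling R x y (fun f => jumpGen c f x) (fun g => jumpGen d g y)) :
    ∃ p ∈ stdSimplex ℝ σ, ∃ q ∈ stdSimplex ℝ τ, IsInvariant c p ∧ IsInvariant d q ∧
      ∀ (f : σ → ℝ) (g : τ → ℝ), (∀ x y, R x y → f x ≤ g y) → ∑ x, p x * f x ≤ ∑ y, q y * g y := by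
  classical
  let W := {z : σ × τ // R z.1 z.2}
  have : Nonempty W := let ⟨x, y, hxy⟩ := hR; ⟨⟨(x, y), hxy⟩⟩
  choose C C0 CR Cl Cr using fun w : W => h w.1.1 w.1.2 w.2
  obtain ⟨π, ⟨π0, π1⟩, hπ⟩ := exists_invariant_mem_stdSimplex (c := fun w z : W => C w z.1)
    (fun w z => C0 w z.1)
  have hsub : ∀ (w : W) (F : σ × τ → ℝ), ∑ z : W, C w z.1 * F z.1 = ∑ z, C w z * F z := by
    intro w F
    rw [← Finset.sum_subtype (Finset.univ.filter fun z : σ × τ => R z.1 z.2) (by simp)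
      (fun z => C w z * F z)]
    exact Finset.sum_filter_of_ne fun z _ hz => CR w z (left_ne_zero_of_mul hz)
  have hp := fun f => sum_fiber_mul π (fun w : W => w.1.1) f
  have hq := fun f => sum_fiber_mul π (fun w : W => w.1.2) f
  refine ⟨fun x => ∑ w : W, if w.1.1 = x then π w else 0,
    ⟨fun x => Finset.sum_nonneg fun w _ => ?_, ?_⟩,
    fun y => ∑ w : W, if w.1.2 = y then π w else 0,
    ⟨fun y => Finset.sum_nonneg fun w _ => ?_, ?_⟩, fun f => ?_, fun g => ?_, fun f g hfg => ?_⟩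
  · split_ifs
    exacts [π0 w, le_rfl]
  · simpa [π1] using hp 1
  · split_ifs
    exacts [π0 w, le_rfl]
  · simpa [π1] using hq 1
  · rw [hp, ← hπ fun w => f w.1.1]
    refine Finset.sum_congr rfl fun w _ => ?_
    exact congrArg (π w * ·) ((Cl w f).symm.trans (hsub w fun z => f z.1 - f w.1.1).symm)
  · rw [hq, ← hπ fun w => g w.1.2]
    refine Finset.sum_congr rfl fun w _ => ?_
    exact congrArg (π w * ·) ((Cr w g).symm.trans (hsub w fun z => g z.2 - g w.1.2).symm)
  · rw [hp, hq]
    exact Finset.sum_le_sum fun w _ => mul_le_mul_of_nonneg_left (hfg _ _ w.2) (π0 w)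

/-! ### The generator of a two-layer loss system -/

theorem sum_layer {M : Type*} [AddCommMonoid M] (f : Layer → M) :
    ∑ i, f i = f .one + f .two := by
  have : (Finset.univ : Finset Layer) = ⟨{.one, .two}, by simp⟩ := by
    ext i; cases i <;> simp
  rw [this]
  simp [Finset.sum]

variable {K : ℕ} {m : Fin K → ℕ} {n : ℕ} {lam mu : Fin K → ℝ} {P : Policy}

theorem generator_mulVec (P : Policy) (m : Fin K → ℕ) (n : ℕ) (lam mu : Fin K → ℝ)
    (f : State m n → ℝ) :
    generator P m n lam mu *ᵥ f = jumpGen (jumpRate P m n lam mu) f := by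
  classical
  ext x
  rw [Matrix.mulVec, dotProduct, jumpGen, ← Finset.add_sum_erase _ _ (Finset.mem_univ x),
    ← Finset.add_sum_erase _ _ (Finset.mem_univ x)]
  simp only [generator, if_true, sub_self, mul_zero, zero_add, mul_sub, Finset.sum_sub_distrib,
    ← Finset.sum_mul]
  have : ∑ y ∈ Finset.univ.erase x, (if x = y then -∑ z ∈ Finset.univ.erase x,
      jumpRate P m n lam mu x z else jumpRate P m n lam mu x y) * f y
      = ∑ y ∈ Finset.univ.erase x, jumpRate P m n lam mu x y * f y :=
    Finset.sum_congr rfl fun y hy => by rw [if_neg (Finset.ne_of_mem_erase hy).symm]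
  convert congrArg (fun t => -(∑ z ∈ Finset.univ.erase x, jumpRate P m n lam mu x z) * f x + t)
    this using 1
  ring

theorem isStationary_iff {p : State m n → ℝ} :
    IsStationary P m n lam mu p ↔
      p ∈ stdSimplex ℝ (State m n) ∧ IsInvariant (jumpRate P m n lam mu) p := by
  classical
  have h1 : (∀ t : ℝ, 0 ≤ t → p ᵥ* transition P m n lam mu t = p) ↔
      p ᵥ* generator P m n lam mu = 0 := by
    rw [← forall_vecMul_exp_eq_iff]
    unfold transition
    convert Iff.rfl
  have h2 : IsInvariant (jumpRate P m n lam mu) p ↔ p ᵥ* generator P m n lam mu = 0 := by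
    rw [← dotProduct_eq_zero_iff]
    refine forall_congr' fun f => ?_
    rw [← Matrix.dotProduct_mulVec, generator_mulVec]
    rfl
  rw [IsStationary, h1, h2]

theorem sum_single_add (f : Fin K → ℕ) (k : Fin K) :
    ∑ l, (f + Pi.single k 1 : Fin K → ℕ) l = ∑ l, f l + 1 := by
  simp only [Pi.add_apply, Finset.sum_add_distrib]
  simp

theorem sub_single_add {f : Fin K → ℕ} {k : Fin K} (h : 0 < f k) :
    f - Pi.single k 1 + Pi.single k 1 = f := by
  ext l
  by_cases e : l = k
  · subst e; simp; omega
  · simp [e]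

theorem sub_single_eq_self {f : Fin K → ℕ} {k : Fin K} (h : f k = 0) :
    f - Pi.single k 1 = f := by
  ext l
  by_cases e : l = k
  · subst e; simp [h]
  · simp [e]

theorem sum_sub_single {f : Fin K → ℕ} {k : Fin K} (h : 0 < f k) :
    ∑ l, (f - Pi.single k 1 : Fin K → ℕ) l + 1 = ∑ l, f l := by
  rw [← sum_single_add, sub_single_add h]

/-- The layer-`i` component of a state. -/
def comp (i : Layer) (x : State m n) : Fin K → ℕ :=
  match i with
  | .one => x.1.1
  | .two => x.1.2

/-- The total number of customers `|x|` as a natural number. -/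
def count (x : State m n) : ℕ := ∑ k, x.1.1 k + ∑ k, x.1.2 k

theorem total_eq_count (x : State m n) : total x = count x := rfl

/-- The state after a class-`k` arrival; `x` itself if the arrival is blocked. -/
def arrive (k : Fin K) (x : State m n) : State m n :=
  if h1 : x.1.1 k < m k then
    ⟨(x.1.1 + Pi.single k 1, x.1.2), fun l => by
      by_cases e : l = k
      · subst e; simpa using h1
      · simpa [Pi.single_apply, e] using x.2.1 l, x.2.2⟩
  else if h2 : ∑ l, x.1.2 l < n then
    ⟨(x.1.1, x.1.2 + Pi.single k 1), x.2.1, (sum_single_add _ k).trans_le h2⟩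
  else x

/-- The state after the departure of a class-`k` customer from layer `i`. By truncated subtraction
this is `x` itself if there is no such customer. -/
def depart (i : Layer) (k : Fin K) (x : State m n) : State m n :=
  match i with
  | .one => ⟨(x.1.1 - Pi.single k 1, x.1.2), fun l => (Nat.sub_le _ _).trans (x.2.1 l), x.2.2⟩
  | .two => ⟨(x.1.1, x.1.2 - Pi.single k 1), x.2.1,
      (Finset.sum_le_sum fun _ _ => Nat.sub_le _ _).trans x.2.2⟩

theorem arrive_of_lt {k : Fin K} {x : State m n} (h : x.1.1 k < m k) :
    (arrive k x).1 = x.1 + unit .one k := by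
  simp [arrive, h, unit, Prod.ext_iff]

theorem arrive_of_eq_of_lt {k : Fin K} {x : State m n} (h : x.1.1 k = m k)
    (h2 : ∑ l, x.1.2 l < n) : (arrive k x).1 = x.1 + unit .two k := by
  simp [arrive, h, h2, unit, Prod.ext_iff]

theorem arrive_of_blocked {k : Fin K} {x : State m n} (h : x.1.1 k = m k)
    (h2 : ∑ l, x.1.2 l = n) : arrive k x = x := by
  simp [arrive, h, h2]

theorem depart_add_unit {i : Layer} {k : Fin K} {x : State m n} (h : 0 < comp i x k) :
    x.1 = (depart i k x).1 + unit i k := by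
  cases i
  · simp only [depart, unit, Prod.ext_iff, Prod.fst_add, Prod.snd_add, add_zero, and_true]
    exact (sub_single_add h).symm
  · simp only [depart, unit, Prod.ext_iff, Prod.fst_add, Prod.snd_add, add_zero, true_and]
    exact (sub_single_add h).symm

theorem comp_pos_of_eq_add {i : Layer} {k : Fin K} {x y : State m n} (h : x.1 = y.1 + unit i k) :
    0 < comp i x k := by
  cases i <;> simp [comp, h, unit]

theorem depart_eq_self {i : Layer} {k : Fin K} {x : State m n} (h : comp i x k = 0) :
    depart i k x = x := by
  cases i
  · exact Subtype.ext (Prod.ext (sub_single_eq_self h) rfl)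
  · exact Subtype.ext (Prod.ext rfl (sub_single_eq_self h))

theorem sum_jump_to (r : ℝ) (x : State m n) {z : State m n} {Q : State m n → Prop}
    [DecidablePred Q]
    (hz : ∀ y, Q y ↔ y = z) (f : State m n → ℝ) :
    ∑ y, (if Q y then r else 0) * (f y - f x) = r * (f z - f x) := by
  classical
  simp [hz]

theorem sum_depart (r : ℝ) (i : Layer) (k : Fin K) (x : State m n) (f : State m n → ℝ) :
    ∑ y : State m n, (if x.1 = y.1 + unit i k then r else 0) * (f y - f x) =
      r * (f (depart i k x) - f x) := by
  rcases (comp i x k).eq_zero_or_pos with h | h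
  · rw [depart_eq_self h, sub_self, mul_zero]
    exact Finset.sum_eq_zero fun y _ => by
      rw [if_neg fun e => (comp_pos_of_eq_add e).ne' h, zero_mul]
  · refine sum_jump_to r x (fun y => ?_) f
    rw [depart_add_unit h, add_left_inj, Subtype.ext_iff, eq_comm]

theorem sum_arrive (k : Fin K) (x : State m n) (f : State m n → ℝ) :
    ∑ i, ∑ y : State m n, (if y.1 = x.1 + unit i k then upRate m n lam i k x else 0) *
      (f y - f x) = lam k * (f (arrive k x) - f x) := by
  rw [sum_layer]
  rcases (x.2.1 k).lt_or_eq with h | h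
  · simp only [upRate, acceptSet, Set.mem_ofPred_eq, h, h.ne, if_true, false_and, if_false,
      ite_self, zero_mul, Finset.sum_const_zero, add_zero]
    exact sum_jump_to _ x (fun y => by rw [Subtype.ext_iff, arrive_of_lt h]) f
  · rcases x.2.2.lt_or_eq with h2 | h2
    · simp only [upRate, acceptSet, Set.mem_ofPred_eq, h, h2, lt_irrefl, if_true, and_self,
        if_false, ite_self, zero_mul, Finset.sum_const_zero, zero_add]
      exact sum_jump_to _ x (fun y => by rw [Subtype.ext_iff, arrive_of_eq_of_lt h h2]) f
    · simp [upRate, acceptSet, h, h2, arrive_of_blocked h h2]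

/-- The generator written with arrival and departure maps, blocked arrivals and void departures
being jumps from `x` to `x`. -/
theorem jumpGen_jumpRate (f : State m n → ℝ) (x : State m n) :
    jumpGen (jumpRate P m n lam mu) f x =
      ∑ k, lam k * (f (arrive k x) - f x) +
        ∑ j : Layer × Fin K, downRate P m n mu j.1 j.2 x * (f (depart j.1 j.2 x) - f x) := by
  classical
  simp only [jumpGen, jumpRate, Finset.sum_mul, add_mul, Finset.sum_add_distrib,
    Fintype.sum_prod_type, ← sum_depart, ← sum_arrive]
  congr 1
  · rw [Finset.sum_comm]
    conv_rhs => rw [Finset.sum_comm]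
    refine Finset.sum_congr rfl fun i _ => ?_
    rw [Finset.sum_comm]
  · rw [Finset.sum_comm]
    refine Finset.sum_congr rfl fun i _ => ?_
    rw [Finset.sum_comm]

/-! ### Existence and uniqueness of the stationary distribution -/

theorem downRate_nonneg (hmu : ∀ k, 0 < mu k) (i : Layer) (k : Fin K) (x : State m n) :
    0 ≤ downRate P m n mu i k x := by
  have := (hmu k).le
  cases P <;> cases i <;> simp only [downRate]
  · positivity
  · positivity
  · split_ifs <;> positivity
  · split_ifs <;> positivity

/-- Both disciplines serve class `k` at the same total rate. -/
theorem sum_layer_downRate (k : Fin K) (x : State m n) :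
    ∑ i, downRate P m n mu i k x = mu k * (x.1.1 k + x.1.2 k) := by
  rw [sum_layer]
  cases P
  · simp only [downRate]; ring
  · rcases (x.1.2 k).eq_zero_or_pos with h | h
    · simp [downRate, h]
    · simp [downRate, h, h.ne']; ring

theorem jumpRate_nonneg (hlam : ∀ k, 0 < lam k) (hmu : ∀ k, 0 < mu k) (x y : State m n) :
    0 ≤ jumpRate P m n lam mu x y := by
  classical
  refine Finset.sum_nonneg fun i _ => Finset.sum_nonneg fun k _ => add_nonneg ?_ ?_
  · unfold upRate
    split_ifs <;> first | exact (hlam k).le | exact le_rfl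
  · split_ifs
    exacts [downRate_nonneg hmu i k x, le_rfl]

theorem jumpRate_depart_pos (hlam : ∀ k, 0 < lam k) (hmu : ∀ k, 0 < mu k) {i : Layer} {k : Fin K}
    {x : State m n} (hi : 0 < comp i x k) (hr : 0 < downRate P m n mu i k x) :
    0 < jumpRate P m n lam mu x (depart i k x) := by
  classical
  have hup : ∀ i k, 0 ≤ upRate m n lam i k x := fun i k => by
    unfold upRate
    split_ifs
    exacts [(hlam k).le, le_rfl]
  have h0 : ∀ i' k', 0 ≤
      (if (depart i k x).1 = x.1 + unit i' k' then upRate m n lam i' k' x else 0) +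
      (if x.1 = (depart i k x).1 + unit i' k' then downRate P m n mu i' k' x else 0) :=
    fun i' k' => by
      refine add_nonneg ?_ ?_ <;> split_ifs <;>
        first | exact hup _ _ | exact downRate_nonneg hmu _ _ x | exact le_rfl
  refine Finset.sum_pos' (fun i' _ => Finset.sum_nonneg fun k' _ => h0 i' k')
    ⟨i, Finset.mem_univ i, Finset.sum_pos' (fun k' _ => h0 i k') ⟨k, Finset.mem_univ k, ?_⟩⟩
  rw [if_pos (depart_add_unit hi)]
  refine add_pos_of_nonneg_of_pos ?_ hr
  split_ifs
  exacts [hup _ _, le_rfl]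

theorem count_depart_add_one {i : Layer} {k : Fin K} {x : State m n} (h : 0 < comp i x k) :
    count (depart i k x) + 1 = count x := by
  cases i
  · have := sum_sub_single (f := x.1.1) (k := k) h
    simp only [count, depart]
    omega
  · have := sum_sub_single (f := x.1.2) (k := k) h
    simp only [count, depart]
    omega

theorem count_le_count_depart_add_one (i : Layer) (k : Fin K) (x : State m n) :
    count x ≤ count (depart i k x) + 1 := by
  rcases (comp i x k).eq_zero_or_pos with h | h
  · rw [depart_eq_self h]; omega
  · exact (count_depart_add_one h).ge

/-- The empty system. -/
def empty (m : Fin K → ℕ) (n : ℕ) : State m n := ⟨(0, 0), by simp⟩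

theorem exists_comp_downRate_pos (hmu : ∀ k, 0 < mu k) {x : State m n} (hx : x ≠ empty m n) :
    ∃ i k, 0 < comp i x k ∧ 0 < downRate P m n mu i k x := by
  by_cases h2 : ∃ k, 0 < x.1.2 k
  · obtain ⟨k, hk⟩ := h2
    have := hmu k
    refine ⟨.two, k, hk, ?_⟩
    cases P <;> simp only [downRate, hk, if_true] <;> positivity
  · push Not at h2
    have h1 : ∃ k, 0 < x.1.1 k := by
      by_contra! h1
      exact hx (Subtype.ext (Prod.ext (funext fun k => Nat.le_zero.1 (h1 k))
        (funext fun k => Nat.le_zero.1 (h2 k))))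
    obtain ⟨k, hk⟩ := h1
    have := hmu k
    refine ⟨.one, k, hk, ?_⟩
    cases P
    · simp only [downRate]; positivity
    · simp only [downRate, Nat.le_zero.1 (h2 k), if_true]; positivity

theorem reflTransGen_empty (hlam : ∀ k, 0 < lam k) (hmu : ∀ k, 0 < mu k) (x : State m n) :
    Relation.ReflTransGen (fun a b => 0 < jumpRate P m n lam mu a b) x (empty m n) := by
  induction h : count x using Nat.strong_induction_on generalizing x with
  | _ c ih =>
    by_cases hx : x = empty m n
    · rw [hx]
    · obtain ⟨i, k, hi, hr⟩ := exists_comp_downRate_pos (P := P) hmu hx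
      have := count_depart_add_one hi
      exact .head (jumpRate_depart_pos hlam hmu hi hr) (ih _ (by omega) _ rfl)

theorem existsUnique_isStationary (P : Policy) (m : Fin K → ℕ) (n : ℕ)
    (hlam : ∀ k, 0 < lam k) (hmu : ∀ k, 0 < mu k) :
    ∃! p, IsStationary P m n lam mu p := by
  have : Nonempty (State m n) := ⟨empty m n⟩
  have hc := jumpRate_nonneg (P := P) (m := m) (n := n) hlam hmu
  obtain ⟨p, hp, hi⟩ := exists_invariant_mem_stdSimplex hc
  refine ⟨p, isStationary_iff.2 ⟨hp, hi⟩, fun q hq => ?_⟩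
  obtain ⟨hq, hqi⟩ := isStationary_iff.1 hq
  exact hqi.unique hc (reflTransGen_empty hlam hmu) hq hp hi

theorem stationary_isStationary (P : Policy) (m : Fin K → ℕ) (n : ℕ)
    (hlam : ∀ k, 0 < lam k) (hmu : ∀ k, 0 < mu k) :
    IsStationary P m n lam mu (stationary P m n lam mu) :=
  Classical.epsilon_spec (existsUnique_isStationary P m n hlam hmu).exists

/-! ### The relation between the coupled systems -/

variable {M : Fin K → ℕ} {N : ℕ} {mulo muup : Fin K → ℝ}

theorem arrive_layer_one (k l : Fin K) (x : State m n) :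
    (arrive k x).1.1 l = x.1.1 l + if l = k ∧ x.1.1 k < m k then 1 else 0 := by
  unfold arrive
  split_ifs <;> simp_all

theorem count_arrive (k : Fin K) (x : State m n) :
    count (arrive k x) = count x + if x.1.1 k < m k ∨ ∑ l, x.1.2 l < n then 1 else 0 := by
  have h1 := sum_single_add x.1.1 k
  have h2 := sum_single_add x.1.2 k
  unfold arrive count
  by_cases h : x.1.1 k < m k
  · simp only [h, dif_pos, true_or, if_true]
    omega
  · by_cases h' : ∑ l, x.1.2 l < n
    · simp only [h, h', dif_pos, dif_neg, or_true, if_true, not_false_eq_true]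
      omega
    · simp [h, h']

theorem depart_one_layer_one (k l : Fin K) (x : State m n) :
    (depart .one k x).1.1 l = x.1.1 l - if l = k then 1 else 0 := by
  simp [depart, Pi.single_apply]

theorem depart_layer_one_le (i : Layer) (k l : Fin K) (x : State m n) :
    (depart i k x).1.1 l ≤ x.1.1 l := by
  cases i
  · exact Nat.sub_le _ _
  · exact le_rfl

theorem downRate_eq_zero {i : Layer} {k : Fin K} {x : State m n} (h : comp i x k = 0) :
    downRate P m n mu i k x = 0 := by
  cases P <;> cases i <;> simp only [comp] at h <;> simp [downRate, h]

/-- The relation maintained between a lower system `x` with `(M, N)` servers and an upper system `y`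
with `(m, n)` servers: for each class, layer 1 of `x` has at least as many vacancies as layer 1 of
`y`, that is `m k - y.1.1 k ≤ M k - x.1.1 k` (stated without subtraction), and `|x| ≤ |y|`. -/
def Dominated (x : State M N) (y : State m n) : Prop :=
  (∀ k, x.1.1 k + m k ≤ y.1.1 k + M k) ∧ count x ≤ count y

namespace Dominated

variable {x : State M N} {y : State m n}

/-- Arrivals are coupled by offering them to both systems. The critical case is an arrival that only
the lower system accepts. -/
theorem arrive (hsum : ∑ k, M k + N = ∑ k, m k + n) (h : Dominated x y) (k : Fin K) :
    Dominated (arrive k x) (arrive k y) := by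
  have hx := x.2
  have hy := y.2
  refine ⟨fun l => ?_, ?_⟩
  · have := h.1 l
    have := hy.1 l
    rw [arrive_layer_one, arrive_layer_one]
    by_cases e : l = k
    · subst e
      split_ifs <;> omega
    · simpa [e] using h.1 l
  · have hle := Finset.sum_le_sum fun l (_ : l ∈ Finset.univ) => h.1 l
    simp only [Finset.sum_add_distrib] at hle
    rw [count_arrive, count_arrive]
    have hc := h.2
    split_ifs with h1 h2 h2
    · omega
    · -- `y` has no vacancy for class `k`, neither in its layer 1 nor in layer 2, whereas `x` has one.
      -- So `x` has strictly more vacancies; both systems having equally many servers,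
      -- `count x < count y`.
      push Not at h2
      have hm := hy.1 k
      simp only [count] at hc ⊢
      rcases h1 with h1 | h1
      · have hlt := Finset.sum_lt_sum (fun l (_ : l ∈ Finset.univ) => h.1 l)
          ⟨k, Finset.mem_univ k, by omega⟩
        simp only [Finset.sum_add_distrib] at hlt
        omega
      · omega
    · omega
    · omega

theorem depart_left (h : Dominated x y) (i : Layer) (k : Fin K) : Dominated (depart i k x) y := by
  refine ⟨fun l => (Nat.add_le_add_right (depart_layer_one_le i k l x) _).trans (h.1 l), ?_⟩
  rcases (comp i x k).eq_zero_or_pos with h0 | h0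
  · rw [depart_eq_self h0]; exact h.2
  · have := count_depart_add_one h0
    have := h.2
    omega

theorem layer_one_depart_right (h : Dominated x y) {j : Layer} {l : Fin K}
    (hj : j = .one → x.1.1 l + m l ≠ y.1.1 l + M l) (k : Fin K) :
    x.1.1 k + m k ≤ (depart j l y).1.1 k + M k := by
  have := h.1 k
  cases j
  · rw [depart_one_layer_one]
    split_ifs with e
    · subst e
      have := hj rfl
      omega
    · exact h.1 k
  · exact h.1 k

theorem depart_right (h : Dominated x y) (hlt : count x < count y) {j : Layer} {l : Fin K}
    (hj : j = .one → x.1.1 l + m l ≠ y.1.1 l + M l) : Dominated x (depart j l y) := by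
  refine ⟨h.layer_one_depart_right hj, ?_⟩
  have := count_le_count_depart_add_one j l y
  omega

theorem depart_both (h : Dominated x y) {i j : Layer} {k l : Fin K} (hi : 0 < comp i x k)
    (hj : j = .one → x.1.1 l + m l ≠ y.1.1 l + M l) :
    Dominated (depart i k x) (depart j l y) := by
  refine ⟨fun k' => (Nat.add_le_add_right (depart_layer_one_le i k k' x) _).trans
    (h.layer_one_depart_right hj k'), ?_⟩
  have := count_le_count_depart_add_one j l y
  have := count_depart_add_one hi
  have := h.2
  omega

theorem depart_one_both (h : Dominated x y) {k : Fin K} (hx : 0 < x.1.1 k) :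
    Dominated (depart .one k x) (depart .one k y) := by
  refine ⟨fun l => ?_, ?_⟩
  · have := h.1 l
    rw [depart_one_layer_one, depart_one_layer_one]
    split_ifs with e
    · subst e; omega
    · exact h.1 l
  · have := count_le_count_depart_add_one .one k y
    have := count_depart_add_one (i := .one) (x := x) hx
    have := h.2
    omega

end Dominated

/-! ### Coupling of the departures and stochastic comparison -/

theorem sum_downRate (x : State m n) :
    ∑ j : Layer × Fin K, downRate P m n mu j.1 j.2 x = ∑ k, mu k * (x.1.1 k + x.1.2 k) := by
  rw [Fintype.sum_prod_type_right]
  exact Finset.sum_congr rfl fun k _ => sum_layer_downRate k x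

theorem count_cast (x : State m n) : (count x : ℝ) = ∑ k, ((x.1.1 k : ℝ) + x.1.2 k) := by
  simp [count, Finset.sum_add_distrib]

theorem mul_count_le {ν : ℝ} (hν : ∀ k, ν ≤ mu k) (x : State m n) :
    ν * count x ≤ ∑ k, mu k * (x.1.1 k + x.1.2 k) := by
  rw [count_cast, Finset.mul_sum]
  exact Finset.sum_le_sum fun k _ => mul_le_mul_of_nonneg_right (hν k) (by positivity)

theorem le_mul_count {ν : ℝ} (hν : ∀ k, mu k ≤ ν) (x : State m n) :
    ∑ k, mu k * (x.1.1 k + x.1.2 k) ≤ ν * count x := by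
  rw [count_cast, Finset.mul_sum]
  exact Finset.sum_le_sum fun k _ => mul_le_mul_of_nonneg_right (hν k) (by positivity)

theorem downRate_one_le (hmu : ∀ k, 0 < mu k) (k : Fin K) (x : State m n) :
    downRate P m n mu .one k x ≤ mu k * x.1.1 k := by
  have := (hmu k).le
  cases P <;> simp only [downRate]
  · exact le_rfl
  · split_ifs
    · exact le_rfl
    · positivity

/-- The rates of the departures that both systems have to make simultaneously: a layer-1 departure
of the upper system from a class whose layer-1 vacancies are equally many in both systems. -/
def forcedRate (P : Policy) (muup : Fin K → ℝ) (x : State M N) (y : State m n)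
    (j : Layer × Fin K) : ℝ :=
  match j.1 with
  | .one => if x.1.1 j.2 + m j.2 = y.1.1 j.2 + M j.2 then downRate P m n muup .one j.2 y else 0
  | .two => 0

/-- The order `muup ≤ ν ≤ mulo` of the service rates allows the forced departures to be synchronized,
and, when `|x| = |y|`, every other departure of the upper system to be accompanied by one of the
lower system. -/
theorem Dominated.localCoupling {x : State M N} {y : State m n} (h : Dominated x y)
    (hmM : ∀ k, m k ≤ M k) (hsum : ∑ k, M k + N = ∑ k, m k + n) (hlam : ∀ k, 0 < lam k)
    (hlo : ∀ k, 0 < mulo k) (hup : ∀ k, 0 < muup k) {ν : ℝ} (hν : ∀ k, muup k ≤ ν)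
    (hν' : ∀ k, ν ≤ mulo k) :
    LocalCoupling Dominated x y (fun f => jumpGen (jumpRate .overflow M N lam mulo) f x)
      (fun g => jumpGen (jumpRate P m n lam muup) g y) := by
  set d := forcedRate P muup x y with hd
  set a : Layer × Fin K → ℝ := fun j => downRate .overflow M N mulo j.1 j.2 x - d j with ha
  set b : Layer × Fin K → ℝ := fun j => downRate P m n muup j.1 j.2 y - d j with hb
  have hd0 : ∀ j, 0 ≤ d j := by
    rintro ⟨i, k⟩
    cases i <;> simp only [hd, forcedRate]
    · split_ifs
      exacts [downRate_nonneg hup _ _ _, le_rfl]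
    · exact le_rfl
  have hb0 : ∀ j, 0 ≤ b j := by
    rintro ⟨i, k⟩
    have := downRate_nonneg (P := P) hup i k y
    cases i <;> simp only [hb, hd, forcedRate]
    · split_ifs
      · simp
      · simpa
    · simpa
  have ha0 : ∀ j, 0 ≤ a j := by
    rintro ⟨i, k⟩
    have h0 := downRate_nonneg (P := .overflow) hlo i k x
    cases i <;> simp only [ha, hd, forcedRate]
    · split_ifs with e
      · rw [sub_nonneg]
        -- equal vacancies and `m ≤ M` leave at least as many busy servers in the lower system
        have hyx : y.1.1 k ≤ x.1.1 k := by
          have e : x.1.1 k + m k = y.1.1 k + M k := e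
          have := hmM k
          omega
        refine (downRate_one_le hup k y).trans ?_
        exact mul_le_mul ((hν k).trans (hν' k)) (by exact_mod_cast hyx) (by positivity) (hlo k).le
      · simpa
    · simpa
  have hdpos : ∀ j, d j ≠ 0 → Dominated (depart j.1 j.2 x) (depart j.1 j.2 y) := by
    rintro ⟨i, k⟩ hj
    cases i <;> simp only [hd, forcedRate] at hj
    · split_ifs at hj with e
      · refine h.depart_one_both ?_
        have hy : comp .one y k ≠ 0 := fun h0 => hj (downRate_eq_zero h0)
        have e : x.1.1 k + m k = y.1.1 k + M k := e
        have := hmM k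
        simp only [comp] at hy
        show 0 < x.1.1 k
        omega
      · exact absurd rfl hj
    · exact absurd rfl hj
  have hapos : ∀ j, a j ≠ 0 → 0 < comp j.1 x j.2 := by
    intro j hj
    by_contra h0
    have hz := downRate_eq_zero (P := .overflow) (mu := mulo) (Nat.eq_zero_of_not_pos h0)
    have h1 := ha0 j
    have h2 := hd0 j
    simp only [ha, hz] at hj h1
    exact hj (by linarith)
  have hbpos : ∀ j, b j ≠ 0 → j.1 = .one → x.1.1 j.2 + m j.2 ≠ y.1.1 j.2 + M j.2 := by
    rintro ⟨i, k⟩ hj rfl e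
    simp only [hb, hd, forcedRate, if_pos e, sub_self, ne_eq, not_true_eq_false] at hj
  have hres : LocalCoupling Dominated x y
      (fun f => ∑ j, a j * (f (depart j.1 j.2 x) - f x))
      (fun g => ∑ j, b j * (g (depart j.1 j.2 y) - g y)) := by
    rcases h.2.lt_or_eq with hlt | heq
    · exact .independent ha0 hb0 (fun j _ => h.depart_left j.1 j.2)
        fun j hj => h.depart_right hlt (hbpos j hj)
    · refine .proportional ha0 hb0 ?_ (fun j _ => h.depart_left j.1 j.2)
        fun i j hi hj => h.depart_both (hapos i hi) (hbpos j hj)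
      simp only [ha, hb, Finset.sum_sub_distrib, sum_downRate]
      refine sub_le_sub_right ((le_mul_count hν y).trans ?_) _
      rw [← heq]
      exact mul_count_le hν' x
  have harr := LocalCoupling.sum (R := Dominated) (x := x) (y := y) Finset.univ
    fun k _ => LocalCoupling.joint_jump (hlam k).le fun _ => h.arrive hsum k
  have hforced := LocalCoupling.sum (R := Dominated) (x := x) (y := y) Finset.univ
    fun j _ => LocalCoupling.joint_jump (hd0 j) (hdpos j)
  convert harr.add (hforced.add hres) using 1 <;> ext f <;>
    simp only [jumpGen_jumpRate, Pi.add_apply, Finset.sum_apply, ← Finset.sum_add_distrib, ← add_mul,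
      ha, hb, add_sub_cancel]

/-- Comparison of an overflow system having `(M, N)` servers with a system of either discipline having
`(m, n)` servers, where the same number of servers is used but more of them are dedicated in the
lower system, and all its service rates dominate those of the upper one. -/
theorem expect_total_le (P : Policy)
    (hmM : ∀ k, m k ≤ M k) (hsum : ∑ k, M k + N = ∑ k, m k + n) (hlam : ∀ k, 0 < lam k)
    (hlo : ∀ k, 0 < mulo k) (hup : ∀ k, 0 < muup k) {ν : ℝ} (hν : ∀ k, muup k ≤ ν)
    (hν' : ∀ k, ν ≤ mulo k) {f : ℝ → ℝ} (hf : Monotone f) :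
    expect (stationary .overflow M N lam mulo) (fun x => f (total x)) ≤
      expect (stationary P m n lam muup) (fun y => f (total y)) := by
  obtain ⟨p, hp, q, hq, hip, hiq, hpq⟩ := exists_invariant_coupled
    (R := (Dominated : State M N → State m n → Prop))
    ⟨empty M N, empty m n, fun k => by simpa [empty] using hmM k, by simp [count, empty]⟩
    fun x y hxy => hxy.localCoupling (P := P) hmM hsum hlam hlo hup hν hν'
  have e1 := (existsUnique_isStationary _ _ _ hlam hlo).unique (isStationary_iff.2 ⟨hp, hip⟩)
    (stationary_isStationary _ _ _ hlam hlo)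
  have e2 := (existsUnique_isStationary _ _ _ hlam hup).unique (isStationary_iff.2 ⟨hq, hiq⟩)
    (stationary_isStationary _ _ _ hlam hup)
  rw [← e1, ← e2]
  exact hpq _ _ fun x y hxy => hf (Nat.cast_le.2 hxy.2)

/-! ### Throughput and blocking -/

theorem throughput_eq :
    throughput P m n lam mu =
      expect (stationary P m n lam mu) fun x => ∑ k, mu k * (x.1.1 k + x.1.2 k) := by
  simp only [throughput, classThroughput, expect, sum_layer_downRate]
  rw [Finset.sum_comm]
  simp only [Finset.mul_sum]

theorem mul_meanNumber_le_throughput (hlam : ∀ k, 0 < lam k) (hmu : ∀ k, 0 < mu k) {ν : ℝ}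
    (hν : ∀ k, ν ≤ mu k) : ν * meanNumber P m n lam mu ≤ throughput P m n lam mu := by
  rw [throughput_eq, meanNumber, expect, expect, Finset.mul_sum]
  refine Finset.sum_le_sum fun x _ => ?_
  rw [mul_left_comm]
  exact mul_le_mul_of_nonneg_left (mul_count_le hν x)
    ((stationary_isStationary P m n hlam hmu).1.1 x)

theorem throughput_le_mul_meanNumber (hlam : ∀ k, 0 < lam k) (hmu : ∀ k, 0 < mu k) {ν : ℝ}
    (hν : ∀ k, mu k ≤ ν) : throughput P m n lam mu ≤ ν * meanNumber P m n lam mu := by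
  rw [throughput_eq, meanNumber, expect, expect, Finset.mul_sum]
  refine Finset.sum_le_sum fun x _ => ?_
  rw [mul_left_comm]
  exact mul_le_mul_of_nonneg_left (le_mul_count hν x)
    ((stationary_isStationary P m n hlam hmu).1.1 x)

open Classical in
/-- The drift of the number of customers: accepted arrivals minus service completions. -/
theorem jumpGen_total (x : State m n) :
    jumpGen (jumpRate P m n lam mu) total x =
      ∑ k, lam k * (1 - if x ∈ blockSet m n k then 1 else 0) -
        ∑ k, mu k * (x.1.1 k + x.1.2 k) := by
  rw [jumpGen_jumpRate, ← sum_downRate (P := P), sub_eq_add_neg, ← Finset.sum_neg_distrib]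
  congr 1
  · refine Finset.sum_congr rfl fun k _ => ?_
    have h1 := x.2.1 k
    have h2 := x.2.2
    rw [total_eq_count, total_eq_count, count_arrive]
    congr 1
    by_cases hb : x ∈ blockSet m n k
    · rw [if_pos hb, if_neg (by have := hb.1; have := hb.2; omega)]
      simp
    · rw [if_neg hb, if_pos (by
        by_contra hc
        exact hb ⟨by omega, by omega⟩)]
      simp
  · refine Finset.sum_congr rfl fun j _ => ?_
    rcases (comp j.1 x j.2).eq_zero_or_pos with h | h
    · rw [downRate_eq_zero h, zero_mul, neg_zero]
    · rw [total_eq_count, total_eq_count, ← count_depart_add_one h]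
      push_cast
      ring

/-- Little's balance of flows: the rate of accepted arrivals equals the throughput. -/
theorem blocking_eq [NeZero K] (hlam : ∀ k, 0 < lam k) (hmu : ∀ k, 0 < mu k) :
    blocking P m n lam mu = 1 - throughput P m n lam mu / ∑ k, lam k := by
  classical
  have hL : 0 < ∑ k, lam k := Finset.sum_pos (fun k _ => hlam k) Finset.univ_nonempty
  have hst := isStationary_iff.1 (stationary_isStationary P m n hlam hmu)
  have h := hst.2 total
  simp only [jumpGen_total, mul_sub, Finset.sum_sub_distrib, mul_one, ← Finset.sum_mul,
    hst.1.2, one_mul] at h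
  have hth : throughput P m n lam mu = ∑ x, stationary P m n lam mu x *
      ∑ k, mu k * (x.1.1 k + x.1.2 k) := throughput_eq
  have hbl : (∑ k, lam k) * blocking P m n lam mu = ∑ x, stationary P m n lam mu x *
      ∑ k, lam k * if x ∈ blockSet m n k then 1 else 0 := by
    simp only [blocking, classBlocking, expect, Finset.mul_sum]
    rw [Finset.sum_comm]
    refine Finset.sum_congr rfl fun x _ => Finset.sum_congr rfl fun k _ => ?_
    field_simp
  rw [← hth, ← hbl] at h
  field_simp
  linarith

end

end TwoLayerLoss

theorem theorem8 {K : ℕ} [NeZero K] (m : Fin K → ℕ) (n : ℕ) (lam mu : Fin K → ℝ)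
    (hlam : ∀ k, 0 < lam k) (hmu : ∀ k, 0 < mu k) :
    -- the processes involved have a unique stationary distribution
    ((∃! p, IsStationary .overflow m n lam mu p) ∧
      (∃! p, IsStationary .maxPacking m n lam (fun _ => muMin mu) p) ∧
      ∀ m' ∈ configs m n, ∃! p, IsStationary .overflow m' 0 lam (fun _ => muMax mu) p) ∧
    -- stochastic bounds of the stationary total number of customers
    (∀ m' ∈ configs m n,
      StLE (stationary .overflow m' 0 lam (fun _ => muMax mu)) total
          (stationary .overflow m n lam mu) total ∧
        StLE (stationary .overflow m n lam mu) total
          (stationary .maxPacking m n lam (fun _ => muMin mu)) total) ∧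
    -- mean number of customers
    ((configs m n).sup' (configs_nonempty m n)
          (fun m' => meanNumber .overflow m' 0 lam (fun _ => muMax mu)) ≤
        meanNumber .overflow m n lam mu ∧
      meanNumber .overflow m n lam mu ≤
        meanNumber .maxPacking m n lam (fun _ => muMin mu)) ∧
    -- mean throughput
    ((configs m n).sup' (configs_nonempty m n)
          (fun m' => (muRatio mu)⁻¹ * throughput .overflow m' 0 lam (fun _ => muMax mu)) ≤
        throughput .overflow m n lam mu ∧
      throughput .overflow m n lam mu ≤
        muRatio mu * throughput .maxPacking m n lam (fun _ => muMin mu)) ∧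
    -- overall blocking probability
    (1 - muRatio mu * (1 - blocking .maxPacking m n lam (fun _ => muMin mu)) ≤
        blocking .overflow m n lam mu ∧
      blocking .overflow m n lam mu ≤
        (configs m n).inf' (configs_nonempty m n)
          (fun m' =>
            1 - (muRatio mu)⁻¹ * (1 - blocking .overflow m' 0 lam (fun _ => muMax mu)))) := by
  have hmin : ∀ k, muMin mu ≤ mu k := fun k => Finset.inf'_le _ (Finset.mem_univ k)
  have hmax : ∀ k, mu k ≤ muMax mu := fun k => Finset.le_sup' _ (Finset.mem_univ k)
  have hmin0 : 0 < muMin mu := (Finset.lt_inf'_iff _).2 fun k _ => hmu k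
  have hmax0 : 0 < muMax mu := (hmu 0).trans_le (hmax 0)
  have hL : 0 < ∑ k, lam k := Finset.sum_pos (fun k _ => hlam k) Finset.univ_nonempty
  have lower : ∀ m' ∈ configs m n, ∀ f : ℝ → ℝ, Monotone f →
      expect (stationary .overflow m' 0 lam (fun _ => muMax mu)) (fun x => f (total x)) ≤
        expect (stationary .overflow m n lam mu) (fun y => f (total y)) := fun m' hm' f hf => by
    obtain ⟨h1, h2⟩ := (mem_configs m n m').1 hm'
    exact expect_total_le .overflow h1 h2 hlam (fun _ => hmax0) hmu hmax (fun _ => le_rfl) hf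
  have upper : ∀ f : ℝ → ℝ, Monotone f →
      expect (stationary .overflow m n lam mu) (fun x => f (total x)) ≤
        expect (stationary .maxPacking m n lam (fun _ => muMin mu)) (fun y => f (total y)) :=
    fun f hf => expect_total_le .maxPacking (fun _ => le_rfl) rfl hlam hmu (fun _ => hmin0)
      (fun _ => le_rfl) hmin hf
  have alo : ∀ m' ∈ configs m n, meanNumber .overflow m' 0 lam (fun _ => muMax mu) ≤
      meanNumber .overflow m n lam mu := fun m' hm' => lower m' hm' id monotone_id
  have aup : meanNumber .overflow m n lam mu ≤
      meanNumber .maxPacking m n lam (fun _ => muMin mu) := upper id monotone_id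
  have tlo : ∀ m' ∈ configs m n,
      (muRatio mu)⁻¹ * throughput .overflow m' 0 lam (fun _ => muMax mu) ≤
        throughput .overflow m n lam mu := fun m' hm' => by
    have h := throughput_le_mul_meanNumber (P := .overflow) (m := m') (n := 0) hlam
      (fun _ => hmax0) fun _ => le_rfl
    calc _ ≤ (muRatio mu)⁻¹ * (muMax mu * meanNumber .overflow m' 0 lam fun _ => muMax mu) :=
          mul_le_mul_of_nonneg_left h (inv_nonneg.2 (div_pos hmax0 hmin0).le)
      _ = muMin mu * meanNumber .overflow m' 0 lam fun _ => muMax mu := by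
          rw [muRatio]
          field_simp
      _ ≤ muMin mu * meanNumber .overflow m n lam mu :=
          mul_le_mul_of_nonneg_left (alo m' hm') hmin0.le
      _ ≤ _ := mul_meanNumber_le_throughput hlam hmu hmin
  have tup : throughput .overflow m n lam mu ≤
      muRatio mu * throughput .maxPacking m n lam (fun _ => muMin mu) := by
    have h := mul_meanNumber_le_throughput (P := .maxPacking) (m := m) (n := n) hlam
      (fun _ => hmin0) fun _ => le_rfl
    calc _ ≤ muMax mu * meanNumber .overflow m n lam mu :=
          throughput_le_mul_meanNumber hlam hmu hmax
      _ ≤ muMax mu * meanNumber .maxPacking m n lam fun _ => muMin mu :=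
          mul_le_mul_of_nonneg_left aup hmax0.le
      _ = muRatio mu * (muMin mu * meanNumber .maxPacking m n lam fun _ => muMin mu) := by
          rw [muRatio]
          field_simp
      _ ≤ _ := mul_le_mul_of_nonneg_left h (div_pos hmax0 hmin0).le
  refine ⟨⟨existsUnique_isStationary _ _ _ hlam hmu,
    existsUnique_isStationary _ _ _ hlam fun _ => hmin0,
    fun m' _ => existsUnique_isStationary _ _ _ hlam fun _ => hmax0⟩,
    fun m' hm' => ⟨fun f _ _ hf => lower m' hm' f hf, fun f _ _ hf => upper f hf⟩,
    ⟨Finset.sup'_le _ _ alo, aup⟩, ⟨Finset.sup'_le _ _ tlo, tup⟩, ?_,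
    Finset.le_inf' _ _ fun m' hm' => ?_⟩
  · rw [blocking_eq hlam hmu, blocking_eq hlam fun _ => hmin0, sub_sub_cancel, ← mul_div_assoc]
    exact sub_le_sub_left (div_le_div_of_nonneg_right tup hL.le) _
  · rw [blocking_eq hlam hmu, blocking_eq hlam fun _ => hmax0, sub_sub_cancel, ← mul_div_assoc]
    exact sub_le_sub_left (div_le_div_of_nonneg_right (tlo m' hm') hL.le) _
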